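/- Let $d\ge 1$, let $0<\alpha\le\beta<\infty$, and let $V\in C^2(\mathbb{R}^d)$ be real-valued with $\alpha I\preceq\nabla^2V(x)\preceq\beta I$ for every $x\in\mathbb{R}^d$ (in the Loewner order on symmetric matrices). Then $e^{-V}$ is Lebesgue integrable on $\mathbb{R}^d$. Let $\pi$ be the probability measure on $\mathbb{R}^d$ with density $e^{-V}/\int_{\mathbb{R}^d}e^{-V(y)}\,\mathrm{d}y$, and for $v\in\mathbb{R}^d$ write $|v|_\infty=\max_{1\le i\le d}|v_i|$. Then $|\nabla V|_\infty^2$ is $\pi$-integrable and $$\sqrt{\mathbb{E}_\pi\big[|\nabla V|_\infty^2\big]}\;\le\;2\,\frac{\beta}{\sqrt{\alpha}}\,\sqrt{\log(2d)}\,.$$ -/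

import Mathlib

open MeasureTheory
open scoped Gradient MatrixOrder

noncomputable section

/-- The Hessian matrix of `V` at `x`: its entry `(i, j)` is the second partial derivative of `V` at
`x` in the directions of the standard basis vectors `i` and `j`. -/
def hessianMatrix {d : ℕ} (V : EuclideanSpace ℝ (Fin d) → ℝ) (x : EuclideanSpace ℝ (Fin d)) :
    Matrix (Fin d) (Fin d) ℝ :=
  Matrix.of fun i j =>
    iteratedFDeriv ℝ 2 V x ![EuclideanSpace.single i 1, EuclideanSpace.single j 1]

/-- The measure on `ℝ^d` with Lebesgue density `exp (-V) / ∫ exp (-V)`. (It is a probability measure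
as soon as `exp (-V)` is integrable.) -/
def gibbsMeasure {d : ℕ} (V : EuclideanSpace ℝ (Fin d) → ℝ) :
    Measure (EuclideanSpace ℝ (Fin d)) :=
  volume.tilted fun x => -V x

/-- The `ℓ^∞` norm `max_i |v i|` of a vector in `ℝ^d`: the norm of the underlying function
`Fin d → ℝ` is the maximum norm. -/
def linftyNorm {d : ℕ} (v : EuclideanSpace ℝ (Fin d)) : ℝ :=
  ‖(WithLp.ofLp v : Fin d → ℝ)‖

end

/-!
The exponential moments of the partial derivatives of `V` come from the translation invariance of
Lebesgue measure. Since the Hessian is at most `β`, Taylor's formula gives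
`V (x - v) ≤ V x - ⟪∇V x, v⟫ + β ‖v‖² / 2`, that is
`exp (⟪∇V x, v⟫) exp (-V x) ≤ exp (β ‖v‖² / 2) exp (-V (x - v))`. Both `exp (-V)` and its translate
have the same integral, so `E exp ⟪∇V, v⟫ ≤ exp (β ‖v‖² / 2)` (`lintegral_exp_inner_gradient_le`):
every partial derivative of `V` is sub-Gaussian with variance proxy `β`. No functional inequality
for the Gibbs measure is involved, and strong convexity serves only to make `exp (-V)` integrable
(`integrable_exp_neg_of_hessianMatrix_ge`).

Averaging the exponential moment over a Gaussian `t` turns it into `E exp (X² / (4β)) ≤ √2`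
(`lintegral_exp_sq_le_sqrt_two`). As the exponential of a maximum is at most the sum of the
exponentials, `E exp (|∇V|_∞² / (4β)) ≤ √2 d ≤ 2 d`, and Jensen's inequality gives
`E |∇V|_∞² ≤ 4 β log (2d)`. Because `α ≤ β`, this is at most `4 (β² / α) log (2d)`.
-/

open scoped ENNReal RealInnerProductSpace

/-! ### Second-order Taylor bounds -/

lemma le_add_of_second_deriv_le {g g' g'' : ℝ → ℝ} {c : ℝ} (hg : ∀ t, HasDerivAt g (g' t) t)
    (hg' : ∀ t, HasDerivAt g' (g'' t) t) (hc : ∀ t, g'' t ≤ c) :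
    g 1 ≤ g 0 + g' 0 + c / 2 := by
  have h1 : Antitone fun t => g' t - c * t := by
    refine antitone_of_hasDerivAt_nonpos (f' := fun t => g'' t - c * 1)
      (fun t => (hg' t).sub ((hasDerivAt_id t).const_mul c)) fun t => ?_
    simpa using hc t
  have hd : ∀ t, HasDerivAt (fun t => g t - g' 0 * t - c / 2 * t ^ 2)
      (g' t - g' 0 * 1 - c / 2 * (2 * t)) t := fun t => by
    refine ((hg t).sub ((hasDerivAt_id t).const_mul (g' 0))).sub (HasDerivAt.const_mul (c / 2) ?_)
    simpa using hasDerivAt_pow 2 t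
  have h2 : AntitoneOn (fun t => g t - g' 0 * t - c / 2 * t ^ 2) (Set.Ici 0) := by
    refine antitoneOn_of_deriv_nonpos (convex_Ici 0)
      (fun t _ => (hd t).continuousAt.continuousWithinAt)
      (fun t _ => (hd t).differentiableAt.differentiableWithinAt) fun t ht => ?_
    rw [interior_Ici] at ht
    have := h1 (le_of_lt ht)
    rw [(hd t).deriv]
    simp only [mul_zero, sub_zero] at this
    linarith
  have := h2 Set.self_mem_Ici (Set.mem_Ici.2 zero_le_one) zero_le_one
  norm_num at this
  linarith

section Gibbs

variable {d : ℕ} {V : EuclideanSpace ℝ (Fin d) → ℝ}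

lemma dotProduct_hessianMatrix_mulVec (V : EuclideanSpace ℝ (Fin d) → ℝ)
    (x v : EuclideanSpace ℝ (Fin d)) :
    v.ofLp ⬝ᵥ (hessianMatrix V x).mulVec v.ofLp = fderiv ℝ (fderiv ℝ V) x v v := by
  have hv : v = ∑ i, v i • EuclideanSpace.single i (1 : ℝ) := by
    simpa using ((EuclideanSpace.basisFun (Fin d) ℝ).sum_repr v).symm
  conv_rhs => rw [hv]
  simp only [map_sum, map_smul, _root_.sum_apply, _root_.smul_apply,
    dotProduct, Matrix.mulVec, hessianMatrix, Matrix.of_apply, iteratedFDeriv_two_apply,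
    Matrix.cons_val_zero, Matrix.cons_val_one, smul_eq_mul, Finset.mul_sum]
  rw [Finset.sum_comm]
  exact Finset.sum_congr rfl fun i _ => Finset.sum_congr rfl fun j _ => by ring

lemma fderiv_fderiv_le_of_hessianMatrix_le {β : ℝ} {x : EuclideanSpace ℝ (Fin d)}
    (h : hessianMatrix V x ≤ β • (1 : Matrix (Fin d) (Fin d) ℝ)) (v : EuclideanSpace ℝ (Fin d)) :
    fderiv ℝ (fderiv ℝ V) x v v ≤ β * ‖v‖ ^ 2 := by
  have := (Matrix.le_iff.1 h).dotProduct_mulVec_nonneg v.ofLp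
  rw [star_trivial, Matrix.sub_mulVec, dotProduct_sub, dotProduct_hessianMatrix_mulVec,
    Matrix.smul_mulVec, Matrix.one_mulVec, dotProduct_smul, sub_nonneg] at this
  rwa [EuclideanSpace.real_norm_sq_eq, ← show v.ofLp ⬝ᵥ v.ofLp = ∑ i, v i ^ 2 by
    simp [dotProduct, sq]]

lemma le_fderiv_fderiv_of_le_hessianMatrix {α : ℝ} {x : EuclideanSpace ℝ (Fin d)}
    (h : α • (1 : Matrix (Fin d) (Fin d) ℝ) ≤ hessianMatrix V x) (v : EuclideanSpace ℝ (Fin d)) :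
    α * ‖v‖ ^ 2 ≤ fderiv ℝ (fderiv ℝ V) x v v := by
  have := (Matrix.le_iff.1 h).dotProduct_mulVec_nonneg v.ofLp
  rw [star_trivial, Matrix.sub_mulVec, dotProduct_sub, dotProduct_hessianMatrix_mulVec,
    Matrix.smul_mulVec, Matrix.one_mulVec, dotProduct_smul, sub_nonneg] at this
  rwa [EuclideanSpace.real_norm_sq_eq, ← show v.ofLp ⬝ᵥ v.ofLp = ∑ i, v i ^ 2 by
    simp [dotProduct, sq]]

lemma hasDerivAt_comp_add_smul (hV : ContDiff ℝ 2 V) (x v : EuclideanSpace ℝ (Fin d)) (t : ℝ) :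
    HasDerivAt (fun t : ℝ => V (x + t • v)) (fderiv ℝ V (x + t • v) v) t := by
  have hl : HasDerivAt (fun t : ℝ => x + t • v) v t := by
    simpa using ((hasDerivAt_id t).smul_const v).const_add x
  exact ((hV.differentiable (by norm_num)) _).hasFDerivAt.comp_hasDerivAt t hl

lemma hasDerivAt_fderiv_comp_add_smul (hV : ContDiff ℝ 2 V) (x v : EuclideanSpace ℝ (Fin d))
    (t : ℝ) :
    HasDerivAt (fun t : ℝ => fderiv ℝ V (x + t • v) v)
      (fderiv ℝ (fderiv ℝ V) (x + t • v) v v) t := by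
  have hl : HasDerivAt (fun t : ℝ => x + t • v) v t := by
    simpa using ((hasDerivAt_id t).smul_const v).const_add x
  have hd : Differentiable ℝ (fderiv ℝ V) :=
    (hV.fderiv_right (m := 1) (by norm_num)).differentiable (by norm_num)
  have := (hd (x + t • v)).hasFDerivAt.comp_hasDerivAt t hl
  simpa using this.clm_apply (hasDerivAt_const t v)

lemma le_add_inner_gradient_add {β : ℝ} (hV : ContDiff ℝ 2 V)
    (h : ∀ x, hessianMatrix V x ≤ β • (1 : Matrix (Fin d) (Fin d) ℝ))
    (x v : EuclideanSpace ℝ (Fin d)) :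
    V (x + v) ≤ V x + ⟪∇ V x, v⟫ + β * ‖v‖ ^ 2 / 2 := by
  have := le_add_of_second_deriv_le (hasDerivAt_comp_add_smul hV x v)
    (hasDerivAt_fderiv_comp_add_smul hV x v)
    fun t => fderiv_fderiv_le_of_hessianMatrix_le (h _) v
  simpa [inner_gradient_left] using this

lemma add_inner_gradient_add_le {α : ℝ} (hV : ContDiff ℝ 2 V)
    (h : ∀ x, α • (1 : Matrix (Fin d) (Fin d) ℝ) ≤ hessianMatrix V x)
    (x v : EuclideanSpace ℝ (Fin d)) :
    V x + ⟪∇ V x, v⟫ + α * ‖v‖ ^ 2 / 2 ≤ V (x + v) := by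
  have := le_add_of_second_deriv_le (fun t => (hasDerivAt_comp_add_smul hV x v t).neg)
    (fun t => (hasDerivAt_fderiv_comp_add_smul hV x v t).neg)
    (fun t => neg_le_neg (le_fderiv_fderiv_of_le_hessianMatrix (h _) v))
  simp only [Pi.neg_apply, one_smul, zero_smul, add_zero] at this
  rw [inner_gradient_left]
  linarith

lemma continuous_gradient (hV : ContDiff ℝ 2 V) : Continuous (∇ V) :=
  (LinearIsometryEquiv.continuous _).comp (hV.continuous_fderiv (by norm_num))

/-! ### The Gibbs measure -/

/-- The second-order lower bound at the origin dominates `exp (-V)` by a Gaussian. -/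
lemma integrable_exp_neg_of_hessianMatrix_ge {α : ℝ} (hα : 0 < α) (hV : ContDiff ℝ 2 V)
    (h : ∀ x, α • (1 : Matrix (Fin d) (Fin d) ℝ) ≤ hessianMatrix V x) :
    Integrable (fun x => Real.exp (-V x)) volume := by
  have hG := ((GaussianFourier.integrable_cexp_neg_mul_sq_norm_add (b := ((α / 2 : ℝ) : ℂ))
    (by simpa using hα) (-1) (∇ V 0)).norm).const_mul (Real.exp (-V 0))
  refine hG.mono' (hV.continuous.neg.rexp.aestronglyMeasurable) (ae_of_all _ fun x => ?_)
  have := add_inner_gradient_add_le hV h 0 x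
  rw [zero_add] at this
  rw [Real.norm_of_nonneg (Real.exp_pos _).le, Complex.norm_exp, ← Real.exp_add, Real.exp_le_exp]
  have e : (-((α / 2 : ℝ) : ℂ) * (‖x‖ : ℂ) ^ 2 + -1 * ((⟪∇ V 0, x⟫ : ℝ) : ℂ)).re
      = -(α / 2) * ‖x‖ ^ 2 + -1 * ⟪∇ V 0, x⟫ := by
    rw [← Complex.ofReal_re (-(α / 2) * ‖x‖ ^ 2 + -1 * ⟪∇ V 0, x⟫)]
    push_cast
    rfl
  rw [e]
  linarith

lemma isProbabilityMeasure_gibbsMeasure (hint : Integrable (fun x => Real.exp (-V x)) volume) :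
    IsProbabilityMeasure (gibbsMeasure V) :=
  isProbabilityMeasure_tilted hint

/-- The weight `exp ⟪∇V x, v⟫` turns the density of the Gibbs measure at `x` into at most
`exp (β ‖v‖² / 2)` times its density at `x - v`, and translates of the density have total
mass one. -/
lemma lintegral_exp_inner_gradient_le {β : ℝ} (hV : ContDiff ℝ 2 V)
    (h : ∀ x, hessianMatrix V x ≤ β • (1 : Matrix (Fin d) (Fin d) ℝ))
    (hint : Integrable (fun x => Real.exp (-V x)) volume) (v : EuclideanSpace ℝ (Fin d)) :
    ∫⁻ x, ENNReal.ofReal (Real.exp ⟪∇ V x, v⟫) ∂(gibbsMeasure V) ≤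
      ENNReal.ofReal (Real.exp (β * ‖v‖ ^ 2 / 2)) := by
  have := isProbabilityMeasure_gibbsMeasure hint
  set Z := ∫ x, Real.exp (-V x) with hZ
  have hmass : ∫⁻ x, ENNReal.ofReal (Real.exp (-V (x - v)) / Z) = 1 := by
    rw [lintegral_sub_right_eq_self (fun x => ENNReal.ofReal (Real.exp (-V x) / Z)) v]
    have h1 : ∫⁻ _, 1 ∂(gibbsMeasure V) = 1 := by simp
    rw [gibbsMeasure, lintegral_tilted] at h1
    simpa using h1
  rw [gibbsMeasure, lintegral_tilted]
  calc ∫⁻ x, ENNReal.ofReal (Real.exp (-V x) / Z) * ENNReal.ofReal (Real.exp ⟪∇ V x, v⟫)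
      ≤ ∫⁻ x, ENNReal.ofReal (Real.exp (β * ‖v‖ ^ 2 / 2)) *
          ENNReal.ofReal (Real.exp (-V (x - v)) / Z) := by
        refine lintegral_mono fun x => ?_
        have hZ0 : 0 ≤ Z := integral_nonneg fun x => (Real.exp_pos _).le
        rw [← ENNReal.ofReal_mul (by positivity), ← ENNReal.ofReal_mul (by positivity)]
        refine ENNReal.ofReal_le_ofReal ?_
        rw [div_mul_eq_mul_div, mul_div_assoc', ← Real.exp_add, ← Real.exp_add]
        refine div_le_div_of_nonneg_right (Real.exp_le_exp.2 ?_) hZ0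
        have := le_add_inner_gradient_add hV h x (-v)
        rw [norm_neg, inner_neg_right, ← sub_eq_add_neg] at this
        linarith
    _ = ENNReal.ofReal (Real.exp (β * ‖v‖ ^ 2 / 2)) := by
        rw [lintegral_const_mul' _ _ ENNReal.ofReal_ne_top, hmass, mul_one]

/-! ### Maxima of sub-Gaussian variables -/

lemma lintegral_exp_mul_sub_sq {b : ℝ} (hb : 0 < b) (y : ℝ) :
    ∫⁻ t : ℝ, ENNReal.ofReal (Real.exp (t * y - b * t ^ 2)) =
      ENNReal.ofReal (√(Real.pi / b)) * ENNReal.ofReal (Real.exp (y ^ 2 / (4 * b))) := by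
  have e : ∀ t : ℝ, ENNReal.ofReal (Real.exp (t * y - b * t ^ 2)) =
      ENNReal.ofReal (Real.exp (-b * (t - y / (2 * b)) ^ 2)) *
        ENNReal.ofReal (Real.exp (y ^ 2 / (4 * b))) := fun t => by
    rw [← ENNReal.ofReal_mul (Real.exp_pos _).le, ← Real.exp_add]
    congr 2
    field_simp
    ring
  simp_rw [e]
  rw [lintegral_mul_const' _ _ ENNReal.ofReal_ne_top,
    lintegral_sub_right_eq_self (fun t => ENNReal.ofReal (Real.exp (-b * t ^ 2))) (y / (2 * b)),
    ← ofReal_integral_eq_lintegral_ofReal (integrable_exp_neg_mul_sq hb)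
      (ae_of_all _ fun t => (Real.exp_pos _).le), integral_gaussian]

/-- A sub-Gaussian variable with variance proxy `β` has `E exp (X² / (4β)) ≤ √2`: up to the factor
`√(π / β)`, `exp (X² / (4β))` is the integral over `t` of `exp (t X - β t²)`, and after exchanging
the integrals the moment bound leaves the Gaussian integral of `exp (-β t² / 2)`. -/
lemma lintegral_exp_sq_le_sqrt_two {Ω : Type*} [MeasurableSpace Ω] {μ : Measure Ω} [SFinite μ]
    {X : Ω → ℝ} (hX : Measurable X) {β : ℝ} (hβ : 0 < β)
    (h : ∀ t : ℝ, ∫⁻ ω, ENNReal.ofReal (Real.exp (t * X ω)) ∂μ ≤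
      ENNReal.ofReal (Real.exp (β * t ^ 2 / 2))) :
    ∫⁻ ω, ENNReal.ofReal (Real.exp (X ω ^ 2 / (4 * β))) ∂μ ≤ ENNReal.ofReal (√2) := by
  have hs : 0 < √(Real.pi / β) := by positivity
  have key : ENNReal.ofReal (√(Real.pi / β)) *
      ∫⁻ ω, ENNReal.ofReal (Real.exp (X ω ^ 2 / (4 * β))) ∂μ ≤
      ENNReal.ofReal (√(Real.pi / β)) * ENNReal.ofReal (√2) := by
    calc _ = ∫⁻ ω, (∫⁻ t : ℝ, ENNReal.ofReal (Real.exp (t * X ω - β * t ^ 2))) ∂μ := by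
          rw [← lintegral_const_mul' _ _ ENNReal.ofReal_ne_top]
          simp_rw [lintegral_exp_mul_sub_sq hβ]
      _ = ∫⁻ t : ℝ, ∫⁻ ω, ENNReal.ofReal (Real.exp (t * X ω - β * t ^ 2)) ∂μ :=
          lintegral_lintegral_swap (by fun_prop)
      _ ≤ ∫⁻ t : ℝ, ENNReal.ofReal (Real.exp (-(β / 2) * t ^ 2)) := by
          refine lintegral_mono fun t => ?_
          simp_rw [sub_eq_add_neg, Real.exp_add, ENNReal.ofReal_mul (Real.exp_pos _).le]
          rw [lintegral_mul_const' _ _ ENNReal.ofReal_ne_top]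
          refine (mul_le_mul_left (h t) _).trans_eq ?_
          rw [← ENNReal.ofReal_mul (Real.exp_pos _).le, ← Real.exp_add]
          congr 2
          ring
      _ = _ := by
          rw [← ofReal_integral_eq_lintegral_ofReal (integrable_exp_neg_mul_sq (half_pos hβ))
            (ae_of_all _ fun t => (Real.exp_pos _).le), integral_gaussian,
            ← ENNReal.ofReal_mul hs.le, ← Real.sqrt_mul (by positivity)]
          congr 2
          field_simp
  exact (ENNReal.mul_le_mul_iff_right (ENNReal.ofReal_pos.2 hs).ne' ENNReal.ofReal_ne_top).1 key

lemma continuous_linftyNorm : Continuous (linftyNorm (d := d)) :=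
  (PiLp.continuous_ofLp 2 _).norm

lemma exp_linftyNorm_sq_div_le_sum (hd : 1 ≤ d) (v : EuclideanSpace ℝ (Fin d)) (c : ℝ) :
    Real.exp (linftyNorm v ^ 2 / c) ≤ ∑ i, Real.exp (v i ^ 2 / c) := by
  have : Nonempty (Fin d) := ⟨⟨0, hd⟩⟩
  obtain ⟨i, hi⟩ := Finite.exists_max fun i => ‖v i‖
  have e : linftyNorm v = ‖v i‖ :=
    le_antisymm ((pi_norm_le_iff_of_nonneg (norm_nonneg _)).2 hi) (norm_le_pi_norm v.ofLp i)
  rw [e, Real.norm_eq_abs, sq_abs]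
  exact Finset.single_le_sum (f := fun i => Real.exp (v i ^ 2 / c))
    (fun j _ => (Real.exp_pos _).le) (Finset.mem_univ i)

/-- A bound on an exponential moment bounds the mean, by Jensen's inequality. -/
lemma integrable_and_integral_le_mul_log {Ω : Type*} [MeasurableSpace Ω] {μ : Measure Ω}
    [IsProbabilityMeasure μ] {Y : Ω → ℝ} (hY : Measurable Y) (hY0 : ∀ ω, 0 ≤ Y ω) {c K : ℝ}
    (hc : 0 < c) (hK : 0 < K)
    (h : ∫⁻ ω, ENNReal.ofReal (Real.exp (Y ω / c)) ∂μ ≤ ENNReal.ofReal K) :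
    Integrable Y μ ∧ ∫ ω, Y ω ∂μ ≤ c * Real.log K := by
  have hm : AEStronglyMeasurable (fun ω => Real.exp (Y ω / c)) μ := by fun_prop
  have hexp : Integrable (fun ω => Real.exp (Y ω / c)) μ :=
    (lintegral_ofReal_ne_top_iff_integrable hm (ae_of_all _ fun ω => (Real.exp_pos _).le)).1
      (h.trans_lt ENNReal.ofReal_lt_top).ne
  have hle : ∫ ω, Real.exp (Y ω / c) ∂μ ≤ K := by
    rw [integral_eq_lintegral_of_nonneg_ae (ae_of_all _ fun ω => (Real.exp_pos _).le) hm]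
    exact ENNReal.toReal_le_of_le_ofReal hK.le h
  -- The tangent line of `exp` at `log K` lies below `exp`.
  have hpt : ∀ ω, Y ω ≤ c * (Real.log K - 1) + c / K * Real.exp (Y ω / c) := fun ω => by
    have h1 := Real.add_one_le_exp (Y ω / c - Real.log K)
    rw [Real.exp_sub, Real.exp_log hK] at h1
    have h2 := mul_le_mul_of_nonneg_left h1 hc.le
    have h3 : c * (Y ω / c) = Y ω := by field_simp
    have h4 : c * (Real.exp (Y ω / c) / K) = c / K * Real.exp (Y ω / c) := by ring
    rw [h4] at h2
    linarith
  have hbound := (integrable_const (μ := μ) (c * (Real.log K - 1))).add (hexp.const_mul (c / K))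
  have hYi : Integrable Y μ := hbound.mono' hY.aestronglyMeasurable
    (ae_of_all _ fun ω => by rw [Real.norm_of_nonneg (hY0 ω)]; exact hpt ω)
  refine ⟨hYi, (integral_mono hYi hbound hpt).trans ?_⟩
  simp only [Pi.add_apply]
  rw [integral_add (integrable_const _) (hexp.const_mul _), integral_const_mul (c / K)]
  have := mul_le_mul_of_nonneg_left hle (div_pos hc hK).le
  rw [div_mul_cancel₀ _ hK.ne'] at this
  simp only [integral_const, probReal_univ, one_smul]
  linarith

end Gibbs

theorem mainTheorem3 {d : ℕ} (hd : 1 ≤ d) (V : EuclideanSpace ℝ (Fin d) → ℝ) (α β : ℝ)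
    (hα : 0 < α) (hαβ : α ≤ β) (hV : ContDiff ℝ 2 V)
    (hconvex : ∀ x, α • (1 : Matrix (Fin d) (Fin d) ℝ) ≤ hessianMatrix V x)
    (hsmooth : ∀ x, hessianMatrix V x ≤ β • (1 : Matrix (Fin d) (Fin d) ℝ)) :
    Integrable (fun x => Real.exp (-V x)) volume ∧
      IsProbabilityMeasure (gibbsMeasure V) ∧
      Integrable (fun x => linftyNorm (∇ V x) ^ 2) (gibbsMeasure V) ∧
      Real.sqrt (∫ x, linftyNorm (∇ V x) ^ 2 ∂(gibbsMeasure V)) ≤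
        2 * (β / Real.sqrt α) * Real.sqrt (Real.log (2 * (d : ℝ))) := by
  have hβ : 0 < β := hα.trans_le hαβ
  have hint := integrable_exp_neg_of_hessianMatrix_ge hα hV hconvex
  have hprob := isProbabilityMeasure_gibbsMeasure hint
  have hgrad := continuous_gradient hV
  have hmeas : ∀ i, Measurable fun x => ∇ V x i := fun i => by
    have : Continuous fun x => ∇ V x i := by fun_prop
    exact this.measurable
  have hd1 : (1 : ℝ) ≤ d := by exact_mod_cast hd
  have hcoord : ∀ i, ∫⁻ x, ENNReal.ofReal (Real.exp ((∇ V x i) ^ 2 / (4 * β))) ∂(gibbsMeasure V) ≤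
      ENNReal.ofReal (√2) := fun i => by
    refine lintegral_exp_sq_le_sqrt_two (hmeas i) hβ fun t => ?_
    have := lintegral_exp_inner_gradient_le hV hsmooth hint (EuclideanSpace.single i t)
    simpa only [EuclideanSpace.inner_single_right, conj_trivial, PiLp.norm_single,
      Real.norm_eq_abs, sq_abs] using this
  have hmax : ∫⁻ x, ENNReal.ofReal (Real.exp (linftyNorm (∇ V x) ^ 2 / (4 * β)))
      ∂(gibbsMeasure V) ≤ ENNReal.ofReal (2 * d) := by
    calc _ ≤ ∫⁻ x, ∑ i, ENNReal.ofReal (Real.exp ((∇ V x i) ^ 2 / (4 * β)))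
          ∂(gibbsMeasure V) := by
          refine lintegral_mono fun x => ?_
          rw [← ENNReal.ofReal_sum_of_nonneg fun i _ => (Real.exp_pos _).le]
          exact ENNReal.ofReal_le_ofReal (exp_linftyNorm_sq_div_le_sum hd _ _)
      _ = ∑ i, ∫⁻ x, ENNReal.ofReal (Real.exp ((∇ V x i) ^ 2 / (4 * β)))
          ∂(gibbsMeasure V) :=
          lintegral_finsetSum _ fun i _ => by have := hmeas i; fun_prop
      _ ≤ ∑ _i : Fin d, ENNReal.ofReal (√2) := Finset.sum_le_sum fun i _ => hcoord i
      _ ≤ ENNReal.ofReal (2 * d) := by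
          rw [← ENNReal.ofReal_sum_of_nonneg fun i _ => Real.sqrt_nonneg _]
          refine ENNReal.ofReal_le_ofReal ?_
          have : √2 ≤ (2 : ℝ) := Real.sqrt_le_iff.2 (by norm_num)
          simp only [Finset.sum_const, Finset.card_univ, Fintype.card_fin, nsmul_eq_mul]
          nlinarith
  obtain ⟨hi, hle⟩ := integrable_and_integral_le_mul_log
    ((continuous_linftyNorm.comp hgrad).pow 2).measurable (fun x => sq_nonneg _)
    (by positivity : 0 < 4 * β) (by positivity : (0 : ℝ) < 2 * d) hmax
  refine ⟨hint, hprob, hi, Real.sqrt_le_iff.2 ⟨by positivity, hle.trans ?_⟩⟩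
  have hlog : 0 ≤ Real.log (2 * (d : ℝ)) := Real.log_nonneg (by linarith)
  rw [mul_pow, mul_pow, div_pow, Real.sq_sqrt hα.le, Real.sq_sqrt hlog]
  refine mul_le_mul_of_nonneg_right ?_ hlog
  have : β ≤ β ^ 2 / α := by
    rw [le_div_iff₀ hα]
    nlinarith
  linarith
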